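/- Let $\mathbb F_q$ be a finite field, let $\epsilon_{q-1}$ be a primitive $(q-1)$-th root of unity, and fix a ring homomorphism $\mathbb Z[\epsilon_{q-1}]\to\mathbb F_q$ (a prime $\mathfrak p'$ of $\mathbb Z[\epsilon_{q-1}]$ with residue field $\mathbb F_q$). Let $\chi_q:\mathbb F_q^\times\to\mathbb Z[\epsilon_{q-1}]^\times$ be the Teichmüller character: $\chi_q(\lambda)$ is the $(q-1)$-th root of unity with $\chi_q(\lambda)\equiv\lambda \bmod \mathfrak p'$. For every $j\in\mathbb Z$ put $\chi_q^{j}(0)=0$. For $H\subseteq\mathbb F_q^d$ and $(a)=(a_1,\dots,a_d)\in\mathbb Z^d$ put $$J_H^{(a)}=\sum_{z\in H}\chi_q^{a_1}(z_1)\cdots\chi_q^{a_d}(z_d).$$ For an affine linear form $\omega$ in $e$ variables over $\mathbb F_q$ and $(b)\in\mathbb Z^e$, the Jacobi sum $J^{(b)}_\omega$ is $J_H^{(b)}$ for $H=\{z\in\mathbb F_q^e:\omega(z)=0\}$. Let $n\mid q-1$, let $\alpha_1,\dots,\alpha_d\in\mathbb F_q$ be distinct, let $0<n_i<n$ for $1\le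 i\le d$ with $n\nmid n_1+\cdots+n_d$, let $c\in\mathbb F_q^\times$, let $g\in\mathbb F_q(x)^\times$, and let $$f=c\,g^n\prod_{i=1}^d(\alpha_i-x)^{n_i}.$$ Let $\Sigma=\mathbb F_q(x)(y)$ with $y^n=f$, let $T=\{\infty,\alpha_1,\dots,\alpha_d\}\subset\mathbb P^1(\mathbb F_q)$, and for $\sigma\in\mathrm{Gal}(\Sigma/\mathbb F_q(x))$ put $\chi_f(\sigma)=\chi_q(\sigma(y)/y)$. For a closed point $x\notin T$ of $\mathbb P^1$ let $F_x$ be its (arithmetic) Frobenius element in this Galois group, and for $x\in T$ put $\chi_f(F_x)=0$. Let $$L(\mathbb P^1,\chi_f,t)=\prod_{x\in|\mathbb P^1|}\bigl(1-\chi_f(F_x)\,t^{\deg x}\bigr)^{-1}\in\mathbb Z[\epsilon_{q-1}][[t]].$$ Put $a_i=n_i\frac{q-1}{n}$, $p(x)=\prod_{i=1}^d(x-\alpha_i)$, and let $\overline H^{r\cdot\infty}$ be the set of images in $\mathbb F_q[x]/p(x)\cong\mathbb F_q^d$, $v\mapsto(v(\alpha_1),\dots,v(\alpha_d))$, of the monic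 polynomials $v$ of degree $r$. (1) The Euler product converges coefficientwise, and $$L(\mathbb P^1,\chi_f,t)=\sum_{r=0}^{d-1}\bigl(\chi_q(c)^{\frac{q-1}{n}}\bigr)^{r}\,J^{(a)}_{\overline H^{r\cdot\infty}}\;t^r .$$ In particular, if $c$ is an $n$-th power in $\mathbb F_q^\times$ (for instance $c=1$), then $L(\mathbb P^1,\chi_f,t)=\sum_{r=0}^{d-1}J^{(a)}_{\overline H^{r\cdot\infty}}\,t^r$. (2) For every $0\le r\le d-1$, $(q-1)^{r(d-r-1)}J^{(a)}_{\overline H^{r\cdot\infty}}$ is a sum of products of $d-r$ Jacobi sums. Precisely, there are affine linear forms $\omega_k=z_k-\sum_{s=1}^r\beta_{ks}z_s-\beta_k$ in the $r+1$ variables $z_1,\dots,z_r,z_k$ ($r+1\le k\le d$) such that $\overline H^{r\cdot\infty}=\{z\in\mathbb F_q^d:\omega_{r+1}(z)=\cdots=\omega_d(z)=0\}$ and $$(q-1)^{r(d-r-1)}J^{(a)}_{\overline H^{r\cdot\infty}}=\sum J_{\omega_{r+1}}^{(i_1^{r+2}+\cdots+i_1^{d}+a_1,\;\dots,\;i_r^{r+2}+\cdots+i_r^{d}+a_r,\;a_{r+1})}\prod_{k=r+2}^{d}J_{\omega_k}^{(-i_1^k,\dots,-i_r^k,\,a_k)},$$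 where the sum is over all families $(i_s^k)$ of integers $0\le i_s^k\le q-2$, $1\le s\le r$, $r+2\le k\le d$. -/

import Mathlib

open Polynomial

noncomputable section

namespace JacobiLSeries

/-- The ring `ℤ[ε_{q-1}]` (inside the cyclotomic field), where `q` is the number of elements
of `F`. -/
abbrev EpsRing (F : Type*) : Type := CyclotomicRing (Nat.card F - 1) ℤ ℚ

section Teichmuller

variable {F : Type*} [Field F] [Finite F]

theorem neZero_card_sub_one : NeZero (Nat.card F - 1) :=
  ⟨by have := Finite.one_lt_card (α := F); omega⟩

theorem neZero_cast_card_sub_one : NeZero ((Nat.card F - 1 : ℕ) : F) := by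
  refine ⟨?_⟩
  rw [Nat.cast_sub Nat.card_pos]
  have : Fintype F := Fintype.ofFinite F
  simp [Nat.card_eq_fintype_card]

/-- Reduction `red : ℤ[ε_{q-1}] → F_q` induces a bijection from the `(q-1)`-th roots of unity
onto `F_qˣ`. -/
theorem bijective_red (red : EpsRing F →+* F) :
    Function.Bijective
      ((Units.map (red : EpsRing F →* F)).comp
        (rootsOfUnity (Nat.card F - 1) (EpsRing F)).subtype) := by
  have h0 : NeZero (Nat.card F - 1) := neZero_card_sub_one
  have h1 : NeZero ((Nat.card F - 1 : ℕ) : F) := neZero_cast_card_sub_one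
  have h2 : NeZero ((Nat.card F - 1 : ℕ) : ℤ) := ⟨by exact_mod_cast h0.out⟩
  have h3 : NeZero ((Nat.card F - 1 : ℕ) : EpsRing F) :=
    ⟨fun h => h1.out (by have := congrArg red h; simpa using this)⟩
  have : Fintype F := Fintype.ofFinite F
  classical
  obtain ⟨ζ, hζ⟩ : ∃ ζ : EpsRing F, IsPrimitiveRoot ζ (Nat.card F - 1) :=
    ⟨_, IsCyclotomicExtension.zeta_spec (Nat.card F - 1) ℤ (EpsRing F)⟩
  have hroot : IsPrimitiveRoot (red ζ) (Nat.card F - 1) := by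
    rw [← Polynomial.isRoot_cyclotomic_iff] at hζ ⊢
    have := hζ.map (f := red)
    simpa using this
  have hcard : Nat.card (rootsOfUnity (Nat.card F - 1) (EpsRing F)) = Nat.card Fˣ := by
    rw [hζ.card_rootsOfUnity, Nat.card_units]
  refine Function.Surjective.bijective_of_nat_card_le (fun u => ?_) hcard.le
  have hu : (u : F) ^ (Nat.card F - 1) = 1 := by
    rw [Nat.card_eq_fintype_card]
    exact FiniteField.pow_card_sub_one_eq_one _ u.ne_zero
  obtain ⟨i, -, hi⟩ := hroot.eq_pow_of_pow_eq_one hu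
  refine ⟨hζ.toRootsOfUnity ^ i, ?_⟩
  ext
  simpa using hi

/-- The Teichmüller character `χ_q : F_q → ℤ[ε_{q-1}]` attached to a reduction map
`red : ℤ[ε_{q-1}] → F_q` (a prime of `ℤ[ε_{q-1}]` together with an identification of its residue
field with `F_q`): `χ_q(λ)` is the `(q-1)`-th root of unity that reduces to `λ`. As for every
`MulChar`, all powers of `χ_q`, including `χ_q ^ 0`, vanish at `0`. -/
def teichmuller (red : EpsRing F →+* F) : MulChar F (EpsRing F) :=
  MulChar.ofUnitHom
    ((rootsOfUnity (Nat.card F - 1) (EpsRing F)).subtype.comp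
      (MulEquiv.ofBijective _ (bijective_red red)).symm.toMonoidHom)

/-- The defining property of the Teichmüller character. -/
theorem red_teichmuller (red : EpsRing F →+* F) (z : F) : red (teichmuller red z) = z := by
  by_cases hz : z = 0
  · subst hz
    rw [MulChar.map_zero, map_zero]
  · lift z to Fˣ using IsUnit.mk0 z hz
    have := (MulEquiv.ofBijective _ (bijective_red red)).apply_symm_apply z
    have h2 := congrArg (Units.val) this
    rw [teichmuller, MulChar.ofUnitHom_coe]
    exact h2

end Teichmuller

section JacobiSums

variable {F R ι : Type*} [Field F] [Fintype F] [CommRing R] [Fintype ι]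

open Classical in
/-- `J_H^{(a)} = ∑_{z ∈ H} ∏_i χ^{a_i}(z_i)` for a subset `H` of `F_q^ι`. -/
def jacobiSumOn (χ : MulChar F R) (a : ι → ℤ) (H : Set (ι → F)) : R :=
  ∑ z : ι → F with z ∈ H, ∏ i, (χ ^ a i) (z i)

/-- The Jacobi sum `J_ω^{(a)} = ∑_{ω(z) = 0} ∏_i χ^{a_i}(z_i)` of the (affine) linear form
`ω(z) = ∑_i γ_i z_i + γ₀`. -/
def jacobiSumForm (χ : MulChar F R) (γ : ι → F) (γ₀ : F) (a : ι → ℤ) : R :=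
  jacobiSumOn χ a {z | (∑ i, γ i * z i) + γ₀ = 0}

end JacobiSums

/-- The image in `F_q[x]/(∏ (x - α_i)) ≅ F_q^d`, `v ↦ (v(α_1), …, v(α_d))`, of the set of monic
polynomials of degree `r`. -/
def monicImage {F : Type*} [Field F] {d : ℕ} (α : Fin d → F) (r : ℕ) : Set (Fin d → F) :=
  {z | ∃ v : F[X], v.Monic ∧ v.natDegree = r ∧ ∀ i, z i = v.eval (α i)}

/-- The closed points of the projective line over `F`: the point at infinity, and one point for
each monic irreducible polynomial. -/
inductive ClosedPoint (F : Type*) [Field F] : Type _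
  | infty : ClosedPoint F
  | finite (P : F[X]) (monic : P.Monic) (irreducible : Irreducible P) : ClosedPoint F

/-- The degree of the residue field of a closed point over `F`. -/
def ClosedPoint.degree {F : Type*} [Field F] : ClosedPoint F → ℕ
  | .infty => 1
  | .finite P _ _ => P.natDegree

section Frobenius

variable {F : Type*} [Field F] {Y : Type*} [Field Y] [Algebra F[X] Y] [Algebra (RatFunc F) Y]

/-- `σ ∈ Gal(Y/F(x))` is a Frobenius element at the point of the affine line given by `P`:
for some prime `Q` above `P` of the integral closure `B` of `F[x]` in `Y`, it induces
`b ↦ b ^ (q ^ deg P)` on `B / Q`. -/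
def IsFrobeniusAt (P : F[X]) (σ : Y ≃ₐ[RatFunc F] Y) : Prop :=
  ∃ Q : Ideal (integralClosure F[X] Y), Q.IsPrime ∧ Q.under F[X] = Ideal.span {P} ∧
    ∀ b b' : integralClosure F[X] Y, (b' : Y) = σ (b : Y) →
      b' - b ^ (Nat.card F ^ P.natDegree) ∈ Q

/-- The Frobenius element `F_x` (well defined at the unramified points of an abelian extension). -/
def frobenius (Y : Type*) [Field Y] [Algebra F[X] Y] [Algebra (RatFunc F) Y] (P : F[X]) :
    Y ≃ₐ[RatFunc F] Y :=
  Classical.epsilon (IsFrobeniusAt P)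

variable [Finite F]

/-- For `y` an `n`-th root of an element of `F(x)` with `n ∣ q - 1`, the scalar `λ ∈ F` such that
`σ y = λ y`. -/
def kummerScalar (y : Y) (σ : Y ≃ₐ[RatFunc F] Y) : F :=
  Classical.epsilon fun l : F => σ y = algebraMap F[X] Y (C l) * y

/-- The character `χ_f(σ) = χ_q(σ(y)/y)` of the Galois group, where `y ^ n = f`. -/
def kummerChar (red : EpsRing F →+* F) (y : Y) (σ : Y ≃ₐ[RatFunc F] Y) : EpsRing F :=
  teichmuller red (kummerScalar y σ)

open Classical in
/-- The value `χ_f(F_x)` at a closed point `x` of the projective line, which is `0` at the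
points of `T = {∞, α_1, …, α_d}`. -/
def charAt {d : ℕ} (red : EpsRing F →+* F) (α : Fin d → F) (y : Y) :
    ClosedPoint F → EpsRing F
  | .infty => 0
  | .finite P _ _ => if ∃ i, P = X - C (α i) then 0 else kummerChar red y (frobenius Y P)

/-- The Euler factor `(1 - χ_f(F_x) t ^ deg x)⁻¹`. -/
def eulerFactor {d : ℕ} (red : EpsRing F →+* F) (α : Fin d → F) (y : Y) (x : ClosedPoint F) :
    PowerSeries (EpsRing F) :=
  PowerSeries.invOfUnit
    (1 - PowerSeries.C (charAt red α y x) * PowerSeries.X ^ x.degree) 1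

/-- `L` is the `L`-series `L(P^1, χ_f, t) = ∏_x (1 - χ_f(F_x) t ^ deg x)⁻¹`: the Euler product over
all closed points converges to `L` in the ring of formal power series, for the topology of
coefficientwise convergence in which coefficients are discrete. -/
def IsLSeries {d : ℕ} (red : EpsRing F →+* F) (α : Fin d → F) (y : Y)
    (L : PowerSeries (EpsRing F)) : Prop :=
  letI : TopologicalSpace (EpsRing F) := ⊥
  letI : TopologicalSpace (PowerSeries (EpsRing F)) :=
    PowerSeries.WithPiTopology.instTopologicalSpace (EpsRing F)
  HasProd (fun x : ClosedPoint F => eulerFactor red α y x) L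

end Frobenius

end JacobiLSeries

end

/-! The values `χ_f(F_P)` extend to a completely multiplicative function of monic polynomials.
Writing `e = (q-1)/n`, the Kummer symbol at `P` is the norm of `f` mod `P` (after removing `g ^ n`)
to the power `e`, and the norm of `α_i - x` is `P(α_i)`. So `χ_f(F_P) = χ_q(c)^(e deg P) ∏
χ_q^{a_i}(P(α_i))`, which also vanishes at the points `α_i` (`charAt_finite`).

The Euler product is then the sum over all monic `v` (`hasProd_monicSeries`). In degree `r ≥ d` the
vectors `(v(α_i))` are equidistributed in `F^d`, and the coefficient is a multiple of a product of
complete sums of nontrivial characters, hence zero. In degree `r < d` evaluation is injective and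
the coefficient is the sum over `monicImage α r`.

For (2), Lagrange interpolation makes the last `d - r` values affine functions of the first `r`.
Expanding all but one of the resulting factors in characters of `(Fˣ)^r` separates the variables, at
the price of `(q-1)^r` for each of the `d-r-1` expanded factors (`sum_mul_prod_sum_teichmuller`). -/

namespace JacobiLSeries

/-! ### Orthogonality of the powers of the Teichmüller character. -/

section Orthogonality

variable {F : Type*} [Field F] [Finite F]

theorem teichmuller_injective (red : EpsRing F →+* F) :
    Function.Injective (teichmuller red) :=
  Function.LeftInverse.injective (red_teichmuller red)

theorem teichmuller_pow_card_sub_one (red : EpsRing F →+* F) :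
    teichmuller red ^ (Nat.card F - 1) = 1 := by
  ext u
  rw [MulChar.pow_apply_coe, ← map_pow, ← Units.val_pow_eq_pow_val]
  simp [← Nat.card_units]

/-- The sum is geometric with ratio `χ_q(z/w)`, a `(q-1)`-th root of unity. By injectivity the ratio
is `1` only for `w = z`; otherwise ratio minus `1` can be cancelled in a domain. -/
theorem sum_pow_teichmuller_div (red : EpsRing F →+* F) (z w : Fˣ) [Decidable (w = z)] :
    ∑ j : Fin (Nat.card F - 1),
        (teichmuller red ^ ((j : ℕ) : ℤ)) z * (teichmuller red ^ (-((j : ℕ) : ℤ))) w =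
      if w = z then ((Nat.card F - 1 : ℕ) : EpsRing F) else 0 := by
  have hterm (j : ℕ) : (teichmuller red ^ (j : ℤ)) z * (teichmuller red ^ (-(j : ℤ))) w =
      (teichmuller red ((z / w : Fˣ) : F)) ^ j := by
    have h : (teichmuller red ^ (-(j : ℤ))) w = (teichmuller red ^ (j : ℤ)) (w⁻¹ : Fˣ) := by
      rw [zpow_neg, MulChar.inv_apply, Ring.inverse_unit]
    rw [h, ← map_mul, ← Units.val_mul, ← div_eq_mul_inv, zpow_natCast, MulChar.pow_apply_coe]
  simp only [hterm]
  rw [Fin.sum_univ_eq_sum_range (fun j => teichmuller red ((z / w : Fˣ) : F) ^ j)]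
  split_ifs with h
  · simp [h]
  · have h1 : teichmuller red ((z / w : Fˣ) : F) - 1 ≠ 0 := by
      rw [sub_ne_zero, ← map_one (teichmuller red), (teichmuller_injective red).ne_iff]
      intro h2
      rw [Units.val_eq_one, div_eq_one] at h2
      exact h h2.symm
    refine (mul_eq_zero.1 (?_ : _ * (teichmuller red ((z / w : Fˣ) : F) - 1) = 0)).resolve_right h1
    rw [geom_sum_mul, ← MulChar.pow_apply_coe, teichmuller_pow_card_sub_one,
      MulChar.one_apply_coe, sub_self]

end Orthogonality

/-! ### Fourier inversion and separation of variables. -/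

section JacobiConvolution

variable {F : Type*} [Field F] [Fintype F] {ι κ : Type*} [Fintype ι] [Fintype κ]

/-- Fourier inversion on `(Fˣ)^ι`. Points `w` with a zero coordinate drop out because every power of
the character, even the zeroth, vanishes at `0`; for the same reason `z` must have nonzero
coordinates. -/
theorem sum_prod_teichmuller_expand [DecidableEq ι] (red : EpsRing F →+* F) (B : (ι → F) → EpsRing F)
    (z : ι → F) (hz : ∀ s, z s ≠ 0) :
    ∑ j : ι → Fin (Nat.card F - 1), (∏ s, (teichmuller red ^ ((j s : ℕ) : ℤ)) (z s)) *
        ∑ w : ι → F, B w * ∏ s, (teichmuller red ^ (-((j s : ℕ) : ℤ))) (w s) =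
      ((Nat.card F - 1 : ℕ) : EpsRing F) ^ Fintype.card ι * B z := by
  classical
  simp only [Finset.mul_sum]
  rw [Finset.sum_comm]
  have key (w : ι → F) : ∑ j : ι → Fin (Nat.card F - 1),
      (∏ s, (teichmuller red ^ ((j s : ℕ) : ℤ)) (z s)) *
        (B w * ∏ s, (teichmuller red ^ (-((j s : ℕ) : ℤ))) (w s)) =
      if w = z then ((Nat.card F - 1 : ℕ) : EpsRing F) ^ Fintype.card ι * B z else 0 := by
    have h1 : ∑ j : ι → Fin (Nat.card F - 1),
        (∏ s, (teichmuller red ^ ((j s : ℕ) : ℤ)) (z s)) *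
          (B w * ∏ s, (teichmuller red ^ (-((j s : ℕ) : ℤ))) (w s)) =
        B w * ∏ s, ∑ j : Fin (Nat.card F - 1),
          (teichmuller red ^ ((j : ℕ) : ℤ)) (z s) * (teichmuller red ^ (-((j : ℕ) : ℤ))) (w s) := by
      rw [Finset.prod_univ_sum, Fintype.piFinset_univ, Finset.mul_sum]
      refine Finset.sum_congr rfl fun j _ => ?_
      rw [Finset.prod_mul_distrib]
      ring
    rw [h1]
    split_ifs with h
    · subst h
      have (s : ι) : ∑ j : Fin (Nat.card F - 1), (teichmuller red ^ ((j : ℕ) : ℤ)) (w s) *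
          (teichmuller red ^ (-((j : ℕ) : ℤ))) (w s) = ((Nat.card F - 1 : ℕ) : EpsRing F) := by
        simpa using sum_pow_teichmuller_div red (Units.mk0 _ (hz s)) (Units.mk0 _ (hz s))
      simp only [this, Finset.prod_const, Finset.card_univ]
      ring
    · obtain ⟨s, hs⟩ := Function.ne_iff.1 h
      rw [Finset.prod_eq_zero (Finset.mem_univ s), mul_zero]
      by_cases hw : w s = 0
      · refine Finset.sum_eq_zero fun j _ => ?_
        rw [hw, MulChar.map_zero, mul_zero]
      · simpa [Units.ext_iff, hs] using
          sum_pow_teichmuller_div red (Units.mk0 _ (hz s)) (Units.mk0 _ hw)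
  simp only [key, Finset.sum_ite_eq', Finset.mem_univ, if_true]

omit [Fintype F] in
-- The factor `χ ^ b` keeps this true at `x = 0` for empty `κ`, where `χ ^ 0` vanishes but the empty
-- product is `1`.
theorem zpow_natCast_sum_apply_mul (χ : MulChar F (EpsRing F)) (j : κ → ℕ) (b : ℤ) (x : F) :
    (χ ^ ((∑ k, (j k : ℤ)) + b)) x = (∏ k, (χ ^ (j k : ℤ)) x) * (χ ^ b) x := by
  classical
  have h (s : Finset κ) : (χ ^ ((∑ k ∈ s, (j k : ℤ)) + b)) x =
      (∏ k ∈ s, (χ ^ (j k : ℤ)) x) * (χ ^ b) x := by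
    induction s using Finset.induction_on with
    | empty => simp
    | insert k s hk ih =>
      rw [Finset.sum_insert hk, Finset.prod_insert hk, add_assoc, zpow_add, MulChar.mul_apply, ih,
        mul_assoc]
  exact h _

/-- Separation of variables by orthogonality of the powers of the Teichmüller character. -/
theorem sum_mul_prod_sum_teichmuller [DecidableEq ι] [DecidableEq κ] (red : EpsRing F →+* F) (a : ι → ℤ)
    (A : (ι → F) → EpsRing F) (B : κ → (ι → F) → EpsRing F) :
    ∑ i : κ → ι → Fin (Nat.card F - 1),
        (∑ z : ι → F, A z *
          ∏ s, (teichmuller red ^ ((∑ k, ((i k s : ℕ) : ℤ)) + a s)) (z s)) *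
        ∏ k, ∑ w : ι → F, B k w * ∏ s, (teichmuller red ^ (-((i k s : ℕ) : ℤ))) (w s) =
      ((Nat.card F - 1 : ℕ) : EpsRing F) ^ (Fintype.card ι * Fintype.card κ) *
        ∑ z : ι → F, A z * (∏ s, (teichmuller red ^ a s) (z s)) * ∏ k, B k z := by
  classical
  simp only [Finset.sum_mul]
  rw [Finset.sum_comm, Finset.mul_sum]
  refine Finset.sum_congr rfl fun z _ => ?_
  have h1 (i : κ → ι → Fin (Nat.card F - 1)) :
      (A z * ∏ s, (teichmuller red ^ ((∑ k, ((i k s : ℕ) : ℤ)) + a s)) (z s)) *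
        ∏ k, ∑ w : ι → F, B k w * ∏ s, (teichmuller red ^ (-((i k s : ℕ) : ℤ))) (w s) =
      (A z * ∏ s, (teichmuller red ^ a s) (z s)) *
        ∏ k, ((∏ s, (teichmuller red ^ ((i k s : ℕ) : ℤ)) (z s)) *
          ∑ w : ι → F, B k w * ∏ s, (teichmuller red ^ (-((i k s : ℕ) : ℤ))) (w s)) := by
    simp only [zpow_natCast_sum_apply_mul, Finset.prod_mul_distrib]
    rw [Finset.prod_comm]
    ring
  simp only [h1]
  -- The summand is a product over `k` of terms depending only on `i k`, so the sum over families
  -- factors over `k`.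
  rw [← Finset.mul_sum, ← Fintype.piFinset_univ, ← Finset.prod_univ_sum (fun _ => Finset.univ)
    (fun k (j : ι → Fin (Nat.card F - 1)) => ((∏ s, (teichmuller red ^ ((j s : ℕ) : ℤ)) (z s)) *
          ∑ w : ι → F, B k w * ∏ s, (teichmuller red ^ (-((j s : ℕ) : ℤ))) (w s)))]
  -- Inversion is available only at nonzero coordinates; elsewhere both sides vanish through the
  -- factor `χ_q^{a_s}(z_s)`.
  by_cases hz : ∀ s, z s ≠ 0
  · simp only [sum_prod_teichmuller_expand red _ z hz, Finset.prod_mul_distrib, Finset.prod_const,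
      Finset.card_univ, ← pow_mul]
    ring
  · push Not at hz
    obtain ⟨s, hs⟩ := hz
    rw [Finset.prod_eq_zero (Finset.mem_univ s) (by rw [hs, MulChar.map_zero])]
    ring

/-- Eliminating the last variable of an affine linear form. -/
theorem jacobiSumForm_snoc {r : ℕ} (χ : MulChar F (EpsRing F)) (β : Fin r → F) (β₀ : F)
    (b : Fin r → ℤ) (b' : ℤ) :
    jacobiSumForm χ (Fin.snoc (fun s => -β s) 1 : Fin (r + 1) → F) (-β₀)
        (Fin.snoc b b' : Fin (r + 1) → ℤ) =
      ∑ w : Fin r → F, (χ ^ b') ((∑ s, β s * w s) + β₀) * ∏ s, (χ ^ b s) (w s) := by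
  classical
  rw [jacobiSumForm, jacobiSumOn]
  refine Finset.sum_bij' (fun z _ => Fin.init z)
    (fun w _ => Fin.snoc w ((∑ s, β s * w s) + β₀)) (fun _ _ => Finset.mem_univ _)
    ?_ ?_ (fun _ _ => by simp) ?_
  · intro w _
    simp [Fin.sum_univ_castSucc]
  · intro z hz
    have hz' : z (Fin.last r) = (∑ s : Fin r, β s * z s.castSucc) + β₀ := by
      simp [Fin.sum_univ_castSucc] at hz
      linear_combination hz
    rw [← Fin.snoc_init_self z]
    simp [Fin.init, hz']
  · intro z hz
    have hz' : z (Fin.last r) = (∑ s : Fin r, β s * z s.castSucc) + β₀ := by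
      simp [Fin.sum_univ_castSucc] at hz
      linear_combination hz
    rw [Fin.prod_univ_castSucc]
    simp [Fin.init, hz', mul_comm]

end JacobiConvolution
-- Splitting coordinates at position `r`.
section SplitCoordinates

/-- Splitting the coordinates `0, …, d - 1` into those below `r`, equal to `r`, and above `r`. -/
noncomputable def finSplitEquiv {d r : ℕ} (hr : r < d) :
    Fin r ⊕ (Unit ⊕ {k : Fin d // r < k}) ≃ Fin d :=
  Equiv.ofBijective
    (Sum.elim (Fin.castLE hr.le) (Sum.elim (fun _ => ⟨r, hr⟩) Subtype.val)) <| by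
    constructor
    · rintro (s | s | ⟨k, hk⟩) (s' | s' | ⟨k', hk'⟩) h <;> simp [Fin.ext_iff] at h ⊢ <;> omega
    · intro k
      rcases lt_trichotomy (k : ℕ) r with h | h | h
      · exact ⟨.inl ⟨k, h⟩, rfl⟩
      · exact ⟨.inr (.inl ()), Fin.ext h.symm⟩
      · exact ⟨.inr (.inr ⟨k, h⟩), rfl⟩

theorem prod_fin_eq_prod_lt_mul_prod_gt {M : Type*} [CommMonoid M] {d r : ℕ} (hr : r < d)
    (f : Fin d → M) :
    ∏ k, f k = (∏ s : Fin r, f (s.castLE hr.le)) * (f ⟨r, hr⟩ *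
      ∏ k : {k : Fin d // r < k}, f k) := by
  rw [← (finSplitEquiv hr).prod_comp, Fintype.prod_sum_type, Fintype.prod_sum_type,
    Fintype.prod_unique (fun u : Unit => _)]
  rfl

theorem card_fin_gt {d r : ℕ} (hr : r < d) :
    Fintype.card {k : Fin d // r < k} = d - r - 1 := by
  have := Fintype.card_congr (finSplitEquiv hr)
  simp only [Fintype.card_sum, Fintype.card_fin, Fintype.card_unit] at this
  omega

end SplitCoordinates

/-! ### Values of monic polynomials as an affine subspace, and its Jacobi sum. -/

section MonicImage

variable {F : Type*} [Field F]

/-- A polynomial `v` is monic of degree `r` exactly when `v - ∏_{s<r} (x - α_s)` has degree below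
`r`. Such a difference is interpolated from the first `r` points, where the nodal polynomial
vanishes. -/
theorem monicImage_eq_setOf_affine {d : ℕ} {α : Fin d → F} (hα : Function.Injective α) {r : ℕ}
    (hr : r < d) :
    monicImage α r = {z | ∀ k : Fin d, r ≤ k →
      z k = (∑ s : Fin r, (Lagrange.basis Finset.univ (α ∘ Fin.castLE hr.le) s).eval (α k) *
        z (s.castLE hr.le)) +
        (Lagrange.nodal Finset.univ (α ∘ Fin.castLE hr.le)).eval (α k)} := by
  set p : Fin r → F := α ∘ Fin.castLE hr.le with hp
  have hpi : Set.InjOn p (Finset.univ : Finset (Fin r)) :=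
    (hα.comp (Fin.castLE_injective _)).injOn
  have hcard : (Finset.univ : Finset (Fin r)).card = r := by simp
  have hnd : (Lagrange.nodal Finset.univ p).natDegree = r := by
    rw [Lagrange.natDegree_nodal, hcard]
  have hnm : (Lagrange.nodal Finset.univ p).Monic := Lagrange.nodal_monic
  have hdeg : (Lagrange.nodal Finset.univ p).degree = r := by
    rw [degree_eq_natDegree hnm.ne_zero, hnd]
  ext z
  constructor
  · rintro ⟨v, hv, hvr, hz⟩ k -
    have hvdeg : v.degree = r := by rw [degree_eq_natDegree hv.ne_zero, hvr]
    have hlt : (v - Lagrange.nodal Finset.univ p).degree <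
        ((Finset.univ : Finset (Fin r)).card : ℕ) := by
      rw [hcard, ← hvdeg]
      exact degree_sub_lt_left (hvdeg.trans hdeg.symm) hv.ne_zero (hv.trans hnm.symm)
    have h := congrArg (eval (α k)) (Lagrange.eq_interpolate hpi hlt)
    rw [eval_sub, sub_eq_iff_eq_add, ← hz k, Lagrange.interpolate_apply, eval_finsetSum] at h
    rw [h]
    congr 1
    refine Finset.sum_congr rfl fun s _ => ?_
    rw [eval_mul, eval_C, eval_sub, Lagrange.eval_nodal_at_node (Finset.mem_univ s), sub_zero,
      hz, mul_comm]
    rfl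
  · intro hz
    have hlt : (Lagrange.interpolate Finset.univ p fun s => z (s.castLE hr.le)).degree <
        (Lagrange.nodal Finset.univ p).degree := by
      simpa [hdeg] using
        Lagrange.degree_interpolate_lt (r := fun s => z (s.castLE hr.le)) hpi
    refine ⟨Lagrange.nodal Finset.univ p +
      Lagrange.interpolate Finset.univ p (fun s => z (s.castLE hr.le)),
      hnm.add_of_left hlt, ?_, fun k => ?_⟩
    · rw [natDegree_add_eq_left_of_degree_lt hlt, hnd]
    · rw [eval_add]
      rcases lt_or_ge (k : ℕ) r with hk | hk
      · obtain ⟨s, rfl⟩ : ∃ s : Fin r, s.castLE hr.le = k := ⟨⟨k, hk⟩, rfl⟩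
        have h1 := Lagrange.eval_nodal_at_node (v := p) (Finset.mem_univ s)
        have h2 := Lagrange.eval_interpolate_at_node (fun s : Fin r => z (s.castLE hr.le)) hpi
          (Finset.mem_univ s)
        rw [hp, Function.comp_apply, ← hp] at h1 h2
        rw [h1, h2, zero_add]
      · rw [hz k hk, Lagrange.interpolate_apply, eval_finsetSum, add_comm]
        congr 1
        refine Finset.sum_congr rfl fun s _ => ?_
        rw [eval_mul, eval_C, mul_comm]

variable [Fintype F]

/-- The first `r` coordinates are free parameters. Coordinate `r` is set apart because it alone
stays unexpanded in the separation of variables, leaving `d-r-1` factors to expand. -/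
theorem jacobiSumOn_setOf_affine {d r : ℕ} (hr : r < d) (χ : MulChar F (EpsRing F))
    (a : Fin d → ℤ) (β : Fin d → Fin r → F) (β₀ : Fin d → F) :
    jacobiSumOn χ a {z | ∀ k : Fin d, r ≤ k →
        z k = (∑ s : Fin r, β k s * z (s.castLE hr.le)) + β₀ k} =
      ∑ w : Fin r → F, (χ ^ a ⟨r, hr⟩) ((∑ s, β ⟨r, hr⟩ s * w s) + β₀ ⟨r, hr⟩) *
        (∏ s, (χ ^ a (s.castLE hr.le)) (w s)) *
        ∏ k : {k : Fin d // r < k}, (χ ^ a k) ((∑ s, β k s * w s) + β₀ k) := by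
  classical
  rw [jacobiSumOn]
  refine Finset.sum_bij' (fun z _ s => z (s.castLE hr.le))
    (fun w _ k => if h : (k : ℕ) < r then w ⟨k, h⟩ else (∑ s, β k s * w s) + β₀ k)
    (fun _ _ => Finset.mem_univ _) ?_ ?_ (fun _ _ => by simp) ?_
  · intro w _
    simp only [Finset.mem_filter, Finset.mem_univ, true_and, Set.mem_ofPred_eq]
    intro k hk
    simp [hk.not_gt]
  · intro z hz
    simp only [Finset.mem_filter, Finset.mem_univ, true_and, Set.mem_ofPred_eq] at hz
    ext k
    split_ifs with h
    · rfl
    · exact (hz k (not_lt.1 h)).symm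
  · intro z hz
    simp only [Finset.mem_filter, Finset.mem_univ, true_and, Set.mem_ofPred_eq] at hz
    rw [prod_fin_eq_prod_lt_mul_prod_gt hr, ← hz ⟨r, hr⟩ le_rfl,
      ← Fintype.prod_congr _ _ fun k : {k : Fin d // r < k} =>
        congrArg (χ ^ a k) (hz k k.2.le)]
    ring

theorem card_sub_one_pow_mul_jacobiSumOn {d r : ℕ} (hr : r < d) (red : EpsRing F →+* F)
    (a : Fin d → ℤ) (β : Fin d → Fin r → F) (β₀ : Fin d → F) :
    ((Nat.card F - 1 : ℕ) : EpsRing F) ^ (r * (d - r - 1)) *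
        jacobiSumOn (teichmuller red) a {z | ∀ k : Fin d, r ≤ k →
          z k = (∑ s : Fin r, β k s * z (s.castLE hr.le)) + β₀ k} =
      ∑ i : {k : Fin d // r < k} → Fin r → Fin (Nat.card F - 1),
        jacobiSumForm (teichmuller red)
            (Fin.snoc (fun s => -β ⟨r, hr⟩ s) 1 : Fin (r + 1) → F) (-β₀ ⟨r, hr⟩)
            (Fin.snoc (fun s => (∑ k, ((i k s : ℕ) : ℤ)) + a (s.castLE hr.le)) (a ⟨r, hr⟩) :
              Fin (r + 1) → ℤ) *
          ∏ k : {k : Fin d // r < k},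
            jacobiSumForm (teichmuller red)
              (Fin.snoc (fun s => -β k s) 1 : Fin (r + 1) → F) (-β₀ k)
              (Fin.snoc (fun s => -((i k s : ℕ) : ℤ)) (a k) : Fin (r + 1) → ℤ) := by
  simp only [jacobiSumForm_snoc]
  rw [jacobiSumOn_setOf_affine,
    sum_mul_prod_sum_teichmuller red (fun s => a (s.castLE hr.le))
      (fun w => (teichmuller red ^ a ⟨r, hr⟩) ((∑ s, β ⟨r, hr⟩ s * w s) + β₀ ⟨r, hr⟩))
      (fun (k : {k : Fin d // r < k}) w =>
        (teichmuller red ^ a k) ((∑ s, β k s * w s) + β₀ k)),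
    card_fin_gt hr, Fintype.card_fin]

end MonicImage

/-! ### Euler products of completely multiplicative functions on monic polynomials. -/

section MonicSeries

variable {F : Type*} [Field F] [Finite F]

theorem finite_setOf_monic_natDegree_eq (F : Type*) [Field F] [Finite F] (r : ℕ) :
    {v : F[X] | v.Monic ∧ v.natDegree = r}.Finite := by
  refine Set.Finite.of_finite_image (f := fun v (i : Fin (r + 1)) => v.coeff i)
    (Set.toFinite _) fun v hv w hw h => ?_
  ext k
  rcases lt_or_ge k (r + 1) with hk | hk
  · exact congrFun h ⟨k, hk⟩
  · rw [coeff_eq_zero_of_natDegree_lt (by rw [hv.2]; omega),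
      coeff_eq_zero_of_natDegree_lt (by rw [hw.2]; omega)]

/-- The monic polynomials of degree `r` over a finite field. -/
noncomputable def monicsOfDegree (F : Type*) [Field F] [Finite F] (r : ℕ) : Finset F[X] :=
  (finite_setOf_monic_natDegree_eq F r).toFinset

@[simp]
theorem mem_monicsOfDegree {r : ℕ} {v : F[X]} :
    v ∈ monicsOfDegree F r ↔ v.Monic ∧ v.natDegree = r := by
  simp [monicsOfDegree]

/-- A closed point of the affine line divides a polynomial if the polynomial vanishes there. -/
def ClosedPoint.Divides : ClosedPoint F → F[X] → Prop
  | .infty, _ => False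
  | .finite P _ _, v => P ∣ v

omit [Finite F] in
@[simp]
theorem ClosedPoint.divides_infty (v : F[X]) : ¬ (ClosedPoint.infty : ClosedPoint F).Divides v :=
  id

omit [Finite F] in
@[simp]
theorem ClosedPoint.divides_finite (P v : F[X]) (h : P.Monic) (hi : Irreducible P) :
    (ClosedPoint.finite P h hi).Divides v ↔ P ∣ v :=
  Iff.rfl

variable {R : Type*} [CommRing R]

open Classical in
/-- The series `∑ ψ(v) t ^ deg v` over the monic polynomials `v` that vanish at no point
of `s`. -/
noncomputable def monicSeries (ψ : F[X] → R) (s : Finset (ClosedPoint F)) : PowerSeries R :=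
  PowerSeries.mk fun r => ∑ v ∈ monicsOfDegree F r with ∀ x ∈ s, ¬ x.Divides v, ψ v

/-- One step of a sieve: `w ↦ P * w` matches the subtracted term with the multiples of `P`, so what
survives is not divisible by `P`. As `P ∉ s`, multiplying by `P` creates no divisor in `s`. -/
theorem one_sub_mul_monicSeries {ψ : F[X] → R}
    (hψ : ∀ v w : F[X], v.Monic → w.Monic → ψ (v * w) = ψ v * ψ w)
    {P : F[X]} (hP : P.Monic) (hPi : Irreducible P) (s : Finset (ClosedPoint F))
    [DecidableEq (ClosedPoint F)] (hs : .finite P hP hPi ∉ s) :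
    (1 - PowerSeries.C (ψ P) * PowerSeries.X ^ P.natDegree) * monicSeries ψ s =
      monicSeries ψ (insert (.finite P hP hPi) s) := by
  classical
  ext r
  rw [sub_mul, one_mul, map_sub, mul_assoc, PowerSeries.coeff_C_mul, PowerSeries.coeff_X_pow_mul',
    sub_eq_iff_eq_add]
  simp only [monicSeries, PowerSeries.coeff_mk]
  rw [← Finset.sum_filter_not_add_sum_filter _ (fun v => P ∣ v)]
  congr 1
  · refine Finset.sum_congr ?_ fun _ _ => rfl
    ext v
    simp only [Finset.mem_filter, Finset.mem_insert, forall_eq_or_imp, ClosedPoint.divides_finite]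
    tauto
  · split_ifs with hr
    · rw [Finset.mul_sum]
      symm
      refine Finset.sum_bij (fun w _ => P * w) ?_ ?_ ?_ ?_
      · intro w hw
        simp only [Finset.mem_filter, mem_monicsOfDegree] at hw ⊢
        refine ⟨⟨⟨hP.mul hw.1.1, ?_⟩, ?_⟩, dvd_mul_right _ _⟩
        · rw [hP.natDegree_mul hw.1.1, hw.1.2]
          omega
        · rintro (_ | ⟨Q, hQ, hQi⟩) hx hdvd
          · exact hdvd
          · rcases hQi.prime.dvd_or_dvd hdvd with h | h
            · have := eq_of_monic_of_associated hQ hP (hQi.associated_of_dvd hPi h)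
              subst this
              exact hs hx
            · exact hw.2 _ hx h
      · intro w _ w' _ h
        exact mul_left_cancel₀ hPi.ne_zero h
      · intro v hv
        simp only [Finset.mem_filter, mem_monicsOfDegree] at hv
        obtain ⟨⟨⟨hv, hvr⟩, hvs⟩, w, rfl⟩ := hv
        have hw : w.Monic := hP.of_mul_monic_left hv
        refine ⟨w, ?_, rfl⟩
        simp only [Finset.mem_filter, mem_monicsOfDegree]
        rw [hP.natDegree_mul hw] at hvr
        refine ⟨⟨hw, by omega⟩, ?_⟩
        rintro (_ | ⟨Q, hQ, hQi⟩) hx hdvd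
        · exact hdvd
        · exact hvs _ hx (hdvd.mul_left P)
      · intro w hw
        simp only [Finset.mem_filter, mem_monicsOfDegree] at hw
        exact (hψ P w hP hw.1.1).symm
    · rw [mul_zero]
      refine Finset.sum_eq_zero fun v hv => ?_
      simp only [Finset.mem_filter, mem_monicsOfDegree] at hv
      have := natDegree_le_of_dvd hv.2 hv.1.1.1.ne_zero
      omega

theorem prod_one_sub_mul_monicSeries {ψ : F[X] → R}
    (hψ : ∀ v w : F[X], v.Monic → w.Monic → ψ (v * w) = ψ v * ψ w)
    {f : ClosedPoint F → R} (hf : f .infty = 0) (hf' : ∀ P h hi, f (.finite P h hi) = ψ P)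
    (s : Finset (ClosedPoint F)) :
    (∏ x ∈ s, (1 - PowerSeries.C (f x) * PowerSeries.X ^ x.degree)) * monicSeries ψ ∅ =
      monicSeries ψ s := by
  classical
  induction s using Finset.induction_on with
  | empty => simp
  | insert x s hx ih =>
    rw [Finset.prod_insert hx, mul_assoc, ih]
    cases x with
    | infty =>
      simp [monicSeries, hf]
    | finite P hP hPi =>
      rw [hf', ← one_sub_mul_monicSeries hψ hP hPi s hx, ClosedPoint.degree]

theorem finite_setOf_closedPoint_degree_le (N : ℕ) : {x : ClosedPoint F | x.degree ≤ N}.Finite := by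
  have h : (insert ClosedPoint.infty (⋃ r ∈ Set.Iic N, {x : ClosedPoint F |
      ∃ v, v.Monic ∧ v.natDegree = r ∧ ∃ h hi, x = .finite v h hi})).Finite := by
    refine Set.Finite.insert _ (Set.Finite.biUnion (Set.finite_Iic N) fun r _ => ?_)
    refine Set.Finite.of_finite_image (f := fun x : ClosedPoint F => match x with
      | .infty => (0 : F[X])
      | .finite P _ _ => P) ((finite_setOf_monic_natDegree_eq F r).subset ?_) ?_
    · rintro _ ⟨_, ⟨v, hv, hvr, h, hi, rfl⟩, rfl⟩
      exact ⟨hv, hvr⟩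
    · rintro _ ⟨v, -, -, h, hi, rfl⟩ _ ⟨v', -, -, h', hi', rfl⟩ heq
      simpa using heq
  refine h.subset ?_
  rintro (_ | ⟨P, hP, hPi⟩) hx
  · exact Set.mem_insert _ _
  · refine Set.mem_insert_of_mem _ (Set.mem_biUnion (x := P.natDegree) hx ?_)
    exact ⟨P, hP, rfl, hP, hPi, rfl⟩

/-- A monic polynomial of positive degree at most `N` has an irreducible factor of degree at most
`N`, so the sieve removes it; only `v = 1` remains. -/
theorem coeff_monicSeries_of_le {ψ : F[X] → R} (hψ1 : ψ 1 = 1) {s : Finset (ClosedPoint F)}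
    {N : ℕ} (hs : ∀ x : ClosedPoint F, x.degree ≤ N → x ∈ s) {k : ℕ} (hk : k ≤ N) :
    PowerSeries.coeff k (monicSeries ψ s) = PowerSeries.coeff k (1 : PowerSeries R) := by
  classical
  rw [monicSeries, PowerSeries.coeff_mk, PowerSeries.coeff_one]
  split_ifs with hk0
  · subst hk0
    rw [Finset.sum_eq_single_of_mem (1 : F[X])]
    · exact hψ1
    · simp only [Finset.mem_filter, mem_monicsOfDegree]
      refine ⟨⟨monic_one, natDegree_one⟩, ?_⟩
      rintro (_ | ⟨P, hP, hPi⟩) _ h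
      · exact h
      · exact hPi.not_isUnit (isUnit_of_dvd_one h)
    · intro v hv hv1
      simp only [Finset.mem_filter, mem_monicsOfDegree] at hv
      exact absurd (hv.1.1.natDegree_eq_zero.1 hv.1.2) hv1
  · refine Finset.sum_eq_zero fun v hv => ?_
    simp only [Finset.mem_filter, mem_monicsOfDegree] at hv
    obtain ⟨⟨hv, hvk⟩, hvs⟩ := hv
    obtain ⟨P, hP, hPi, hdvd⟩ := exists_monic_irreducible_factor v
      (fun h => hk0 (hvk ▸ natDegree_eq_zero_of_isUnit h))
    have hle := natDegree_le_of_dvd hdvd hv.ne_zero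
    exact absurd hdvd (hvs (.finite P hP hPi) (hs _ (show P.natDegree ≤ N by omega)))

/-- The Euler product of a completely multiplicative function on monic polynomials. -/
theorem hasProd_monicSeries {ψ : F[X] → R} (hψ1 : ψ 1 = 1)
    (hψ : ∀ v w : F[X], v.Monic → w.Monic → ψ (v * w) = ψ v * ψ w)
    {f : ClosedPoint F → R} (hf : f .infty = 0) (hf' : ∀ P h hi, f (.finite P h hi) = ψ P) :
    letI : TopologicalSpace R := ⊥
    letI : TopologicalSpace (PowerSeries R) := PowerSeries.WithPiTopology.instTopologicalSpace R
    HasProd (fun x : ClosedPoint F => PowerSeries.invOfUnit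
      (1 - PowerSeries.C (f x) * PowerSeries.X ^ x.degree) 1) (monicSeries ψ ∅) := by
  let : TopologicalSpace R := ⊥
  refine (PowerSeries.WithPiTopology.tendsto_iff_coeff_tendsto _ _ _ _).2 fun N => ?_
  rw [SummationFilter.unconditional_filter]
  refine tendsto_nhds_of_eventually_eq ?_
  filter_upwards [Filter.eventually_ge_atTop
    (finite_setOf_closedPoint_degree_le (F := F) N).toFinset] with s hs
  have hs' (x : ClosedPoint F) (hx : x.degree ≤ N) : x ∈ s := hs (by simpa using hx)
  -- Positive degrees give each factor constant coefficient `1`, so that `invOfUnit` with unit `1`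
  -- is a true inverse.
  have hdeg (x : ClosedPoint F) : x.degree ≠ 0 := by
    cases x with
    | infty => exact one_ne_zero
    | finite P hP hPi => exact hPi.natDegree_pos.ne'
  have hunit : (∏ x ∈ s, PowerSeries.invOfUnit
      (1 - PowerSeries.C (f x) * PowerSeries.X ^ x.degree) 1) *
      ∏ x ∈ s, (1 - PowerSeries.C (f x) * PowerSeries.X ^ x.degree) = 1 := by
    rw [← Finset.prod_mul_distrib]
    refine Finset.prod_eq_one fun x _ => PowerSeries.invOfUnit_mul _ _ ?_
    simp [hdeg x]
  have hZ : monicSeries ψ ∅ = (∏ x ∈ s, PowerSeries.invOfUnit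
      (1 - PowerSeries.C (f x) * PowerSeries.X ^ x.degree) 1) * monicSeries ψ s := by
    rw [← prod_one_sub_mul_monicSeries hψ hf hf' s, ← mul_assoc, hunit, one_mul]
  -- Compare the partial product times `1` with the partial product times `monicSeries ψ s`: the
  -- second factors agree up to degree `N`.
  rw [hZ, ← mul_one (∏ x ∈ s, _), mul_assoc, one_mul, PowerSeries.coeff_mul, PowerSeries.coeff_mul]
  refine Finset.sum_congr rfl fun ij hij => ?_
  rw [coeff_monicSeries_of_le hψ1 hs' (by have := Finset.HasAntidiagonal.mem_antidiagonal.1 hij; omega)]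

end MonicSeries

/-! ### Coefficients of the series: vanishing for `r ≥ d`, Jacobi sums for `r < d`. -/

section Coefficients

variable {F : Type*} [Field F] [Fintype F]

theorem teichmuller_zpow_ne_one (red : EpsRing F →+* F) {a : ℕ} (ha : 0 < a)
    (ha' : a < Nat.card F - 1) : teichmuller red ^ (a : ℤ) ≠ 1 := by
  intro h
  obtain ⟨u, hu⟩ := IsCyclic.exists_ofOrder_eq_natCard (α := Fˣ)
  have h1 : (teichmuller red ^ (a : ℤ)) u = 1 := by rw [h, MulChar.one_apply_coe]
  rw [zpow_natCast, MulChar.pow_apply_coe, ← map_pow, ← map_one (teichmuller red)] at h1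
  have h2 := teichmuller_injective red h1
  have h3 : u ^ a = 1 := Units.ext (by simpa using h2)
  have h4 := orderOf_dvd_of_pow_eq_one h3
  rw [hu, Nat.card_units] at h4
  exact absurd (Nat.le_of_dvd ha h4) (by omega)

/-- The function `v ↦ u ^ deg v ∏ χ_i(v(α_i))` on monic polynomials. -/
noncomputable def evalChar {d : ℕ} {R : Type*} [CommRing R] (u : R) (χ : Fin d → MulChar F R)
    (α : Fin d → F) (v : F[X]) : R :=
  u ^ v.natDegree * ∏ i, χ i (v.eval (α i))

variable {d : ℕ} {R : Type*} [CommRing R] (u : R) (χ : Fin d → MulChar F R) (α : Fin d → F)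

omit [Fintype F] in
theorem evalChar_one : evalChar u χ α 1 = 1 := by
  simp [evalChar]

omit [Fintype F] in
theorem evalChar_mul (v w : F[X]) (hv : v.Monic) (hw : w.Monic) :
    evalChar u χ α (v * w) = evalChar u χ α v * evalChar u χ α w := by
  simp only [evalChar, hv.natDegree_mul hw, eval_mul, map_mul, Finset.prod_mul_distrib, pow_add]
  ring

variable {α}

/-- Translation by the interpolating polynomial of `z`, of degree below `d ≤ r`, preserves being
monic of degree `r` and carries one fibre to the other. -/
theorem card_monicsOfDegree_fiber [DecidableEq F] (hα : Function.Injective α) {r : ℕ} (hr : d ≤ r)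
    (z : Fin d → F) :
    ((monicsOfDegree F r).filter fun v => (fun i => v.eval (α i)) = z).card =
      ((monicsOfDegree F r).filter fun v => (fun i => v.eval (α i)) = 0).card := by
  have hdeg : (Lagrange.interpolate Finset.univ α z).degree < (r : WithBot ℕ) :=
    (Lagrange.degree_interpolate_lt z hα.injOn).trans_le (by simpa using hr)
  have hev (i : Fin d) : (Lagrange.interpolate Finset.univ α z).eval (α i) = z i :=
    Lagrange.eval_interpolate_at_node _ hα.injOn (Finset.mem_univ i)
  refine Finset.card_bij' (fun v _ => v - Lagrange.interpolate Finset.univ α z)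
    (fun v _ => v + Lagrange.interpolate Finset.univ α z) ?_ ?_
    (fun _ _ => sub_add_cancel _ _) (fun _ _ => add_sub_cancel_right _ _)
  · intro v hv
    simp only [Finset.mem_filter, mem_monicsOfDegree] at hv ⊢
    have hlt : (Lagrange.interpolate Finset.univ α z).degree < v.degree := by
      rwa [degree_eq_natDegree hv.1.1.ne_zero, hv.1.2]
    refine ⟨⟨hv.1.1.sub_of_left hlt, ?_⟩, ?_⟩
    · rw [natDegree_eq_of_degree_eq (degree_sub_eq_left_of_degree_lt hlt), hv.1.2]
    · ext i
      rw [eval_sub, hev, ← hv.2]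
      simp
  · intro v hv
    simp only [Finset.mem_filter, mem_monicsOfDegree] at hv ⊢
    have hlt : (Lagrange.interpolate Finset.univ α z).degree < v.degree := by
      rwa [degree_eq_natDegree hv.1.1.ne_zero, hv.1.2]
    refine ⟨⟨hv.1.1.add_of_left hlt, ?_⟩, ?_⟩
    · rw [natDegree_add_eq_left_of_degree_lt hlt, hv.1.2]
    · ext i
      rw [eval_add, hev, congrFun hv.2 i]
      simp

/-- By equidistribution the sum is a multiple of `∏_i ∑_x χ_i(x)`, whose factors vanish; `0 < d`
ensures that there is one. -/
theorem sum_monicsOfDegree_evalChar_eq_zero [IsDomain R] (hα : Function.Injective α)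
    (hχ : ∀ i, χ i ≠ 1) (hd : 0 < d) {r : ℕ} (hr : d ≤ r) :
    ∑ v ∈ monicsOfDegree F r, evalChar u χ α v = 0 := by
  classical
  rw [← Finset.sum_fiberwise (monicsOfDegree F r) (fun v i => v.eval (α i))]
  have h (z : Fin d → F) :
      ∑ v ∈ monicsOfDegree F r with (fun i => v.eval (α i)) = z, evalChar u χ α v =
        ((monicsOfDegree F r).filter fun v => (fun i => v.eval (α i)) = 0).card *
          u ^ r * ∏ i, χ i (z i) := by
    rw [← card_monicsOfDegree_fiber hα hr z, mul_assoc, ← nsmul_eq_mul]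
    refine Finset.sum_eq_card_nsmul fun v hv => ?_
    simp only [Finset.mem_filter, mem_monicsOfDegree] at hv
    rw [evalChar, hv.1.2, ← hv.2]
  rw [Finset.sum_congr rfl fun z _ => h z, ← Finset.mul_sum, ← Fintype.piFinset_univ,
    ← Finset.prod_univ_sum (fun _ => Finset.univ) (fun i x => χ i x),
    Finset.prod_eq_zero (Finset.mem_univ ⟨0, hd⟩) (MulChar.sum_eq_zero_of_ne_one (hχ _)), mul_zero]

/-- Two monic polynomials of degree `r` differ by degree below `r < d`, so their values at the `d`
points determine them. -/
theorem sum_monicsOfDegree_evalChar_zpow (χ : MulChar F R) (a : Fin d → ℤ)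
    (hα : Function.Injective α) {r : ℕ} (hr : r < d) :
    ∑ v ∈ monicsOfDegree F r, evalChar u (fun i => χ ^ a i) α v =
      u ^ r * jacobiSumOn χ a (monicImage α r) := by
  classical
  rw [jacobiSumOn, Finset.mul_sum]
  refine Finset.sum_bij (fun v _ i => v.eval (α i)) ?_ ?_ ?_ ?_
  · intro v hv
    rw [mem_monicsOfDegree] at hv
    simpa using ⟨v, hv.1, hv.2, fun _ => rfl⟩
  · intro v hv w hw h
    rw [mem_monicsOfDegree] at hv hw
    refine eq_of_degree_sub_lt_of_eval_index_eq Finset.univ hα.injOn ?_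
      fun i _ => congrFun h i
    have hlt : (v - w).degree < v.degree := degree_sub_lt_left
      (by rw [degree_eq_natDegree hv.1.ne_zero, degree_eq_natDegree hw.1.ne_zero, hv.2, hw.2])
      hv.1.ne_zero (hv.1.trans hw.1.symm)
    refine hlt.trans_le ?_
    rw [degree_eq_natDegree hv.1.ne_zero, hv.2]
    simpa using hr.le
  · intro z hz
    rw [Finset.mem_filter] at hz
    obtain ⟨-, v, hv, hvr, hz⟩ := hz
    exact ⟨v, by simp [hv, hvr], funext fun i => (hz i).symm⟩
  · intro v hv
    rw [mem_monicsOfDegree] at hv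
    rw [evalChar, hv.2]

theorem monicSeries_evalChar [IsDomain R] (χ : MulChar F R) (a : Fin d → ℤ)
    (hα : Function.Injective α) (hχ : ∀ i, χ ^ a i ≠ 1) (hd : 0 < d) :
    monicSeries (evalChar u (fun i => χ ^ a i) α) ∅ =
      ∑ r ∈ Finset.range d, PowerSeries.monomial r
        (u ^ r * jacobiSumOn χ a (monicImage α r)) := by
  classical
  ext k
  rw [map_sum, monicSeries, PowerSeries.coeff_mk]
  simp only [PowerSeries.coeff_monomial, Finset.sum_ite_eq, Finset.mem_range, Finset.notMem_empty,
    IsEmpty.forall_iff, implies_true, Finset.filter_true]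
  split_ifs with hk
  · exact sum_monicsOfDegree_evalChar_zpow u χ a hα hk
  · exact sum_monicsOfDegree_evalChar_eq_zero u _ hα hχ hd (not_lt.1 hk)

end Coefficients

/-! ### Kummer theory over `F(x)` and the Kummer symbol as a norm. -/

section Kummer

variable {F : Type*} [Field F] [Finite F]

theorem exists_isPrimitiveRoot_of_dvd_card_sub_one {n : ℕ} (hn : n ∣ Nat.card F - 1) :
    ∃ ζ : F, IsPrimitiveRoot ζ n := by
  obtain ⟨u, hu⟩ := IsCyclic.exists_ofOrder_eq_natCard (α := Fˣ)
  have h : IsPrimitiveRoot (u : F) (Nat.card F - 1) := by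
    rw [IsPrimitiveRoot.coe_units_iff, ← Nat.card_units, ← hu]
    exact IsPrimitiveRoot.orderOf u
  obtain ⟨e, he⟩ := hn
  exact ⟨_, h.pow (by have := Finite.one_lt_card (α := F); omega) (he.trans (mul_comm _ _))⟩

theorem natCast_ne_zero_of_dvd_card_sub_one {n : ℕ} (hn : n ∣ Nat.card F - 1) : (n : F) ≠ 0 := by
  intro h
  obtain ⟨e, he⟩ := hn
  exact (neZero_cast_card_sub_one (F := F)).out (by rw [he, Nat.cast_mul, h, zero_mul])

variable {Y : Type*} [Field Y] [Algebra F[X] Y] [Algebra (RatFunc F) Y]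
  [IsScalarTower F[X] (RatFunc F) Y]

omit [Finite F] in
theorem algebraMap_polynomial_injective : Function.Injective (algebraMap F[X] Y) := by
  rw [IsScalarTower.algebraMap_eq F[X] (RatFunc F) Y]
  exact (algebraMap (RatFunc F) Y).injective.comp (IsFractionRing.injective F[X] (RatFunc F))

theorem isSplittingField_of_pow_eq {n : ℕ} (hn : n ∣ Nat.card F - 1) {y : Y} {f : RatFunc F}
    (hy : y ^ n = algebraMap (RatFunc F) Y f) (hY : IntermediateField.adjoin (RatFunc F) {y} = ⊤) :
    (X ^ n - C f : (RatFunc F)[X]).IsSplittingField (RatFunc F) Y := by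
  obtain ⟨ζ, hζ⟩ := exists_isPrimitiveRoot_of_dvd_card_sub_one hn
  have hn0 : 0 < n := Nat.pos_of_dvd_of_pos hn (by have := Finite.one_lt_card (α := F); omega)
  have hζY := hζ.map_of_injective (f := (algebraMap F[X] Y).comp C)
    (algebraMap_polynomial_injective.comp C_injective)
  rw [isSplittingField_iff_intermediateField]
  constructor
  · simpa using X_pow_sub_C_splits_of_isPrimitiveRoot hζY hy
  · rw [eq_top_iff, ← hY]
    refine IntermediateField.adjoin.mono _ _ _ ?_
    rw [Set.singleton_subset_iff, mem_rootSet_of_ne (X_pow_sub_C_ne_zero hn0 _)]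
    simp [hy]

theorem isGalois_of_pow_eq {n : ℕ} (hn : n ∣ Nat.card F - 1) {y : Y} {f : RatFunc F} (hf : f ≠ 0)
    (hy : y ^ n = algebraMap (RatFunc F) Y f) (hY : IntermediateField.adjoin (RatFunc F) {y} = ⊤) :
    IsGalois (RatFunc F) Y := by
  have := isSplittingField_of_pow_eq hn hy hY
  refine IsGalois.of_separable_splitting_field (p := X ^ n - C f) (separable_X_pow_sub_C f ?_ hf)
  have h := (algebraMap F (RatFunc F)).injective.ne (natCast_ne_zero_of_dvd_card_sub_one hn)
  simpa using h

theorem exists_eq_algebraMap_C_mul {n : ℕ} (hn : n ∣ Nat.card F - 1) {y : Y} {f : RatFunc F}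
    (hf : f ≠ 0) (hy : y ^ n = algebraMap (RatFunc F) Y f) (σ : Y ≃ₐ[RatFunc F] Y) :
    ∃ l : F, σ y = algebraMap F[X] Y (C l) * y := by
  obtain ⟨ζ, hζ⟩ := exists_isPrimitiveRoot_of_dvd_card_sub_one hn
  have hn0 : 0 < n := Nat.pos_of_dvd_of_pos hn (by have := Finite.one_lt_card (α := F); omega)
  have : NeZero n := ⟨hn0.ne'⟩
  have hζY := hζ.map_of_injective (f := (algebraMap F[X] Y).comp C)
    (algebraMap_polynomial_injective.comp C_injective)
  have hfY : algebraMap (RatFunc F) Y f ≠ 0 := by simpa using hf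
  have hy0 : y ≠ 0 := by
    rintro rfl
    rw [zero_pow hn0.ne'] at hy
    exact hfY hy.symm
  have h1 : (σ y / y) ^ n = 1 := by
    rw [div_pow, ← map_pow, hy, AlgEquiv.commutes, div_self hfY]
  obtain ⟨i, -, hi⟩ := hζY.eq_pow_of_pow_eq_one h1
  refine ⟨ζ ^ i, ?_⟩
  rw [eq_div_iff hy0] at hi
  rw [← hi]
  simp

omit [Finite F] in
theorem natCard_adjoinRoot {P : F[X]} (hP : P.Monic) :
    Nat.card (AdjoinRoot P) = Nat.card F ^ P.natDegree := by
  have := Module.Finite.of_basis (AdjoinRoot.powerBasis' hP).basis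
  rw [Module.natCard_eq_pow_finrank (K := F), (AdjoinRoot.powerBasis' hP).finrank,
    AdjoinRoot.powerBasis'_dim]

/-- The integral closure is finite over `F[x]`, with `F[x]` as its Galois invariants, so a prime `Q`
above `P` has finite residue field and a Frobenius exists there, ramified or not. `galRestrict`
transports it to `Y`. -/
theorem exists_isFrobeniusAt [FiniteDimensional (RatFunc F) Y] [IsGalois (RatFunc F) Y]
    {P : F[X]} (hP : P.Monic) (hPi : Irreducible P) :
    ∃ σ : Y ≃ₐ[RatFunc F] Y, IsFrobeniusAt P σ := by
  have hfin : Module.Finite F[X] (integralClosure F[X] Y) :=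
    IsIntegralClosure.finite F[X] (RatFunc F) Y (integralClosure F[X] Y)
  have : IsFractionRing (integralClosure F[X] Y) Y :=
    integralClosure.isFractionRing_of_finite_extension (RatFunc F) Y
  have : Algebra.IsInvariant F[X] (integralClosure F[X] Y)
      (integralClosure F[X] Y ≃ₐ[F[X]] integralClosure F[X] Y) :=
    Algebra.isInvariant_of_isGalois' F[X] (RatFunc F) Y (integralClosure F[X] Y)
  have : (Ideal.span {P}).IsMaximal := PrincipalIdealRing.isMaximal_of_irreducible hPi
  have hinj : Function.Injective (algebraMap F[X] (integralClosure F[X] Y)) := by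
    have h : Function.Injective (algebraMap F[X] Y) := algebraMap_polynomial_injective
    rw [IsScalarTower.algebraMap_eq F[X] (integralClosure F[X] Y) Y, RingHom.coe_comp] at h
    exact Function.Injective.of_comp h
  obtain ⟨Q, hQ, hQP⟩ := Ideal.exists_ideal_over_maximal_of_isIntegral
    (S := integralClosure F[X] Y) (Ideal.span {P})
    (by rw [(RingHom.injective_iff_ker_eq_bot _).1 hinj]; exact bot_le)
  have hcard : Nat.card (F[X] ⧸ Q.under F[X]) = Nat.card F ^ P.natDegree := by
    rw [Ideal.under, hQP]
    exact natCard_adjoinRoot hP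
  have : Finite (F[X] ⧸ Q.under F[X]) := Nat.finite_of_card_ne_zero <| by
    rw [hcard]
    exact pow_ne_zero _ Nat.card_pos.ne'
  have : Module.Finite (F[X] ⧸ Q.under F[X]) (integralClosure F[X] Y ⧸ Q) := by
    have : Module.Finite F[X] (integralClosure F[X] Y ⧸ Q) := inferInstance
    exact Module.Finite.of_restrictScalars_finite F[X] _ _
  have : Finite (integralClosure F[X] Y ⧸ Q) :=
    Module.finite_of_finite (F[X] ⧸ Q.under F[X])
  have : Finite (integralClosure F[X] Y ≃ₐ[F[X]] integralClosure F[X] Y) :=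
    Finite.of_equiv _ (galRestrict F[X] (RatFunc F) Y (integralClosure F[X] Y)).toEquiv
  obtain ⟨τ, hτ⟩ := IsArithFrobAt.exists_of_isInvariant F[X]
    (integralClosure F[X] Y ≃ₐ[F[X]] integralClosure F[X] Y) Q
  refine ⟨(galRestrict F[X] (RatFunc F) Y (integralClosure F[X] Y)).symm τ, Q, hQ.isPrime, hQP,
    fun b b' hb => ?_⟩
  have hbτ : b' = τ b := Subtype.ext <| hb.trans <|
    galRestrict_symm_algebraMap_apply F[X] (RatFunc F) τ b
  rw [hbτ, ← hcard]
  exact hτ b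

omit [IsScalarTower F[X] (RatFunc F) Y] in
/-- The Kummer symbol: a Frobenius element at `P` multiplies an `n`-th root of `h` by
`h ^ ((q ^ deg P - 1) / n)` modulo `P`. -/
theorem dvd_pow_sub_C_of_isFrobeniusAt {n : ℕ} {P h : F[X]} (hh : ¬ P ∣ h)
    (hn0 : n ≠ 0) (hn : n ∣ Nat.card F ^ P.natDegree - 1) {y : Y}
    (hy : y ^ n = algebraMap F[X] Y h)
    {σ : Y ≃ₐ[RatFunc F] Y} (hσ : IsFrobeniusAt P σ) {l : F}
    (hl : σ y = algebraMap F[X] Y (C l) * y) :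
    P ∣ h ^ ((Nat.card F ^ P.natDegree - 1) / n) - C l := by
  obtain ⟨Q, hQ, hQP, hfrob⟩ := hσ
  have hint : IsIntegral F[X] y :=
    IsIntegral.of_pow (Nat.pos_of_ne_zero hn0) (hy ▸ isIntegral_algebraMap)
  let b : integralClosure F[X] Y := ⟨y, hint⟩
  have hbn : b ^ n = algebraMap F[X] _ h := Subtype.ext hy
  have hbQ : b ∉ Q := by
    intro hb
    have h1 : h ∈ Q.under F[X] := by
      rw [Ideal.under, Ideal.mem_comap, ← hbn]
      exact Ideal.pow_mem_of_mem Q hb n (Nat.pos_of_ne_zero hn0)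
    rw [hQP, Ideal.mem_span_singleton] at h1
    exact hh h1
  have h2 := hfrob b (algebraMap F[X] _ (C l) * b) hl.symm
  -- Split off one factor `b` and group the rest into powers of `b ^ n = h`. Since `b ∉ Q`, it
  -- cancels modulo `Q`, and the congruence descends to `F[X]`.
  have hpow : b ^ (Nat.card F ^ P.natDegree) =
      algebraMap F[X] _ (h ^ ((Nat.card F ^ P.natDegree - 1) / n)) * b := by
    rw [map_pow, ← hbn, ← pow_mul, Nat.mul_div_cancel' hn, ← pow_succ,
      Nat.sub_add_cancel (Nat.one_le_pow _ _ Nat.card_pos)]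
  rw [hpow, ← sub_mul, ← map_sub] at h2
  have h3 := (hQ.mem_or_mem h2).resolve_right hbQ
  have h4 : C l - h ^ ((Nat.card F ^ P.natDegree - 1) / n) ∈ Q.under F[X] := h3
  rw [hQP, Ideal.mem_span_singleton] at h4
  rw [← neg_sub]
  exact h4.neg_right

omit [Finite F] in
-- Multiplication by the root has characteristic polynomial `P`, and the norm is that polynomial
-- evaluated at `a`. The order `a - x` avoids a sign `(-1)^(deg P)`.
theorem norm_mk_C_sub_X {P : F[X]} (hP : P.Monic) (hPi : Irreducible P) (a : F) :
    Algebra.norm F (AdjoinRoot.mk P (C a - X)) = P.eval a := by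
  classical
  have hmin : minpoly F (AdjoinRoot.root P) = P := by
    have := Fact.mk hPi
    rw [AdjoinRoot.minpoly_root hPi.ne_zero, hP.leadingCoeff]
    simp
  have h := Matrix.eval_charpoly
    (Algebra.leftMulMatrix (AdjoinRoot.powerBasis' hP).basis (AdjoinRoot.root P)) a
  have h2 := charpoly_leftMulMatrix (AdjoinRoot.powerBasis' hP)
  rw [AdjoinRoot.powerBasis'_gen, hmin] at h2
  rw [h2] at h
  rw [h, Algebra.norm_eq_matrix_det (AdjoinRoot.powerBasis' hP).basis, map_sub, map_sub,
    AdjoinRoot.mk_X, AdjoinRoot.mk_C]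
  congr 2
  exact AlgHom.commutes (Algebra.leftMulMatrix (AdjoinRoot.powerBasis' hP).basis) a

/-- The norm from the residue field is the power `(q^deg P - 1)/(q - 1)`; its `(q-1)/n`-th power is
therefore the exponent of the Kummer symbol. -/
theorem eq_norm_pow_of_dvd {n : ℕ} (hn : n ∣ Nat.card F - 1) {P h : F[X]} (hP : P.Monic)
    (hPi : Irreducible P) {l : F} (hl : P ∣ h ^ ((Nat.card F ^ P.natDegree - 1) / n) - C l) :
    l = Algebra.norm F (AdjoinRoot.mk P h) ^ ((Nat.card F - 1) / n) := by
  have := Fact.mk hPi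
  have : Finite (AdjoinRoot P) := Nat.finite_of_card_ne_zero <| by
    rw [natCard_adjoinRoot hP]
    exact pow_ne_zero _ Nat.card_pos.ne'
  have hdvd : Nat.card F - 1 ∣ Nat.card F ^ P.natDegree - 1 := by
    simpa using Nat.sub_dvd_pow_sub_pow (Nat.card F) 1 P.natDegree
  apply (algebraMap F (AdjoinRoot P)).injective
  rw [map_pow, FiniteField.algebraMap_norm_eq_pow, natCard_adjoinRoot hP, ← pow_mul,
    Nat.div_mul_div_comm hdvd hn, mul_comm (Nat.card F - 1) n,
    Nat.mul_div_mul_right _ _ (by have := Finite.one_lt_card (α := F); omega)]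
  rw [← AdjoinRoot.mk_eq_mk, map_pow, AdjoinRoot.mk_C] at hl
  exact hl.symm

end Kummer

/-! ### The character values at closed points. -/

section KummerCharacter

variable {F : Type*} [Field F] [Finite F] {d : ℕ}

omit [Finite F] in
theorem exists_eq_X_sub_C_of_dvd {P : F[X]} (hP : P.Monic) (hPi : Irreducible P) {c : F}
    (hc : c ≠ 0) {α : Fin d → F} {m : Fin d → ℕ}
    (h : P ∣ C c * ∏ i, (C (α i) - X) ^ m i) : ∃ i, P = X - C (α i) := by
  rcases hPi.prime.dvd_or_dvd h with h | h
  · exact absurd (isUnit_of_dvd_unit h (isUnit_C.2 hc.isUnit)) hPi.not_isUnit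
  · obtain ⟨i, -, hi⟩ := (hPi.prime.dvd_finsetProd_iff _).1 h
    have h2 : P ∣ X - C (α i) := by
      rw [← neg_sub]
      exact (hPi.prime.dvd_of_dvd_pow hi).neg_right
    exact ⟨i, eq_of_monic_of_associated hP (monic_X_sub_C _)
      (hPi.associated_of_dvd (irreducible_X_sub_C _) h2)⟩

theorem teichmuller_norm_pow (red : EpsRing F →+* F) {e : ℕ} (he : 0 < e) {P : F[X]}
    (hP : P.Monic) (hPi : Irreducible P) (c : F) (α : Fin d → F) {m : Fin d → ℕ}
    (hm : ∀ i, 0 < m i) :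
    teichmuller red
        (Algebra.norm F (AdjoinRoot.mk P (C c * ∏ i, (C (α i) - X) ^ m i)) ^ e) =
      evalChar (teichmuller red c ^ e) (fun i => teichmuller red ^ ((m i * e : ℕ) : ℤ)) α P := by
  -- Positivity of the exponent matters at `z = 0`, where `χ ^ 0` gives `0` but an ordinary zeroth
  -- power gives `1`.
  have hchar (i : Fin d) (z : F) :
      (teichmuller red ^ ((m i * e : ℕ) : ℤ)) z = (teichmuller red z ^ m i) ^ e := by
    rw [zpow_natCast, MulChar.pow_apply' _ (Nat.mul_pos (hm i) he).ne', pow_mul]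
  have hconst : Algebra.norm F (AdjoinRoot.mk P (C c)) = c ^ P.natDegree := by
    have := Fact.mk hPi
    rw [AdjoinRoot.mk_C]
    refine (Algebra.norm_algebraMap c).trans ?_
    rw [(AdjoinRoot.powerBasis' hP).finrank, AdjoinRoot.powerBasis'_dim]
  simp only [evalChar, hchar, map_mul, map_prod, map_pow, hconst, norm_mk_C_sub_X hP hPi,
    Finset.prod_pow, mul_pow]
  rw [← pow_mul, ← pow_mul, mul_comm e]

variable {Y : Type*} [Field Y] [Algebra F[X] Y] [Algebra (RatFunc F) Y]
  [IsScalarTower F[X] (RatFunc F) Y]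

theorem charAt_finite (red : EpsRing F →+* F) {n : ℕ} (hn : n ∣ Nat.card F - 1)
    (α : Fin d → F) {m : Fin d → ℕ} (hm : ∀ i, 0 < m i) {c : F} (hc : c ≠ 0)
    {g : RatFunc F} (hg : g ≠ 0) {y : Y}
    (hy : y ^ n = algebraMap (RatFunc F) Y (g ^ n * algebraMap F[X] (RatFunc F)
      (C c * ∏ i, (C (α i) - X) ^ m i)))
    (hY : IntermediateField.adjoin (RatFunc F) {y} = ⊤)
    {P : F[X]} (hP : P.Monic) (hPi : Irreducible P) :
    charAt red α y (.finite P hP hPi) =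
      evalChar (teichmuller red c ^ ((Nat.card F - 1) / n))
        (fun i => teichmuller red ^ ((m i * ((Nat.card F - 1) / n) : ℕ) : ℤ)) α P := by
  have hq : 0 < Nat.card F - 1 := by have := Finite.one_lt_card (α := F); omega
  have hn0 : 0 < n := Nat.pos_of_dvd_of_pos hn hq
  rw [charAt]
  split_ifs with hPα
  · obtain ⟨i, rfl⟩ := hPα
    rw [evalChar, Finset.prod_eq_zero (Finset.mem_univ i) ?_, mul_zero]
    rw [eval_sub, eval_X, eval_C, sub_self, MulChar.map_zero]
  · set h : F[X] := C c * ∏ i, (C (α i) - X) ^ m i with hh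
    have hPh : ¬ P ∣ h := fun hdvd => hPα (exists_eq_X_sub_C_of_dvd hP hPi hc hdvd)
    have hh0 : h ≠ 0 := by
      intro h0
      exact hPh (h0 ▸ dvd_zero P)
    have hf : g ^ n * algebraMap F[X] (RatFunc F) h ≠ 0 :=
      mul_ne_zero (pow_ne_zero _ hg)
        ((map_ne_zero_iff _ (IsFractionRing.injective F[X] (RatFunc F))).2 hh0)
    have := isSplittingField_of_pow_eq hn hy hY
    have : FiniteDimensional (RatFunc F) Y :=
      Polynomial.IsSplittingField.finiteDimensional Y
        (X ^ n - C (g ^ n * algebraMap F[X] (RatFunc F) h))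
    have := isGalois_of_pow_eq hn hf hy hY
    -- Only the Frobenius property of the chosen element is used, so the value does not depend on
    -- the choice.
    have hfrob : IsFrobeniusAt P (frobenius Y P) :=
      Classical.epsilon_spec (exists_isFrobeniusAt hP hPi)
    have hl : frobenius Y P y = algebraMap F[X] Y (C (kummerScalar y (frobenius Y P))) * y :=
      Classical.epsilon_spec (exists_eq_algebraMap_C_mul hn hf hy (frobenius Y P))
    have hgY : algebraMap (RatFunc F) Y g ≠ 0 := by simpa using hg
    -- Dividing by `g` makes the `n`-th power a polynomial prime to `P`, even if `g` has a zero or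
    -- pole there; Galois fixes `g`, so the scalar is unchanged.
    have hy' : (y / algebraMap (RatFunc F) Y g) ^ n = algebraMap F[X] Y h := by
      rw [div_pow, hy, map_mul, map_pow, mul_div_cancel_left₀ _ (pow_ne_zero _ hgY),
        ← IsScalarTower.algebraMap_apply]
    have hl' : frobenius Y P (y / algebraMap (RatFunc F) Y g) =
        algebraMap F[X] Y (C (kummerScalar y (frobenius Y P))) *
          (y / algebraMap (RatFunc F) Y g) := by
      rw [map_div₀, AlgEquiv.commutes, hl, mul_div_assoc]
    have hdvd : n ∣ Nat.card F ^ P.natDegree - 1 :=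
      hn.trans (by simpa using Nat.sub_dvd_pow_sub_pow (Nat.card F) 1 P.natDegree)
    have hnorm := eq_norm_pow_of_dvd hn hP hPi
      (dvd_pow_sub_C_of_isFrobeniusAt hPh hn0.ne' hdvd hy' hfrob hl')
    rw [kummerChar, hnorm, hh, teichmuller_norm_pow red
      (Nat.div_pos (Nat.le_of_dvd hq hn) hn0) hP hPi c α hm]

end KummerCharacter

end JacobiLSeries

/-! ### Assembly of both statements. -/

theorem corollary4p4 {F : Type*} [Field F] [Fintype F]
    (red : JacobiLSeries.EpsRing F →+* F)
    (n d : ℕ) (hn : n ∣ Nat.card F - 1)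
    (α : Fin d → F) (hα : Function.Injective α)
    (m : Fin d → ℕ) (hm : ∀ i, 0 < m i ∧ m i < n)
    (h_infty : ¬ n ∣ ∑ i, m i)
    (c : F) (hc : c ≠ 0) (g : RatFunc F) (hg : g ≠ 0)
    {Y : Type*} [Field Y] [Algebra (Polynomial F) Y] [Algebra (RatFunc F) Y]
    [IsScalarTower (Polynomial F) (RatFunc F) Y]
    (y : Y)
    (hy : y ^ n = algebraMap (RatFunc F) Y (g ^ n * algebraMap (Polynomial F) (RatFunc F)
      (Polynomial.C c * ∏ i, (Polynomial.C (α i) - Polynomial.X) ^ m i)))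
    (hY : IntermediateField.adjoin (RatFunc F) {y} = ⊤)
    (a : Fin d → ℤ) (ha : ∀ i, a i = m i * ((Nat.card F - 1) / n : ℕ)) :
    JacobiLSeries.IsLSeries red α y
      (∑ r ∈ Finset.range d, PowerSeries.monomial r
        ((JacobiLSeries.teichmuller red c ^ ((Nat.card F - 1) / n)) ^ r *
          JacobiLSeries.jacobiSumOn (JacobiLSeries.teichmuller red) a
            (JacobiLSeries.monicImage α r))) ∧
    ∀ (r : ℕ) (hr : r < d),
      ∃ (β : Fin d → Fin r → F) (β₀ : Fin d → F),
        JacobiLSeries.monicImage α r =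
          {z | ∀ k : Fin d, r ≤ k →
            z k = (∑ s : Fin r, β k s * z (s.castLE hr.le)) + β₀ k} ∧
        ((Nat.card F - 1 : ℕ) : JacobiLSeries.EpsRing F) ^ (r * (d - r - 1)) *
            JacobiLSeries.jacobiSumOn (JacobiLSeries.teichmuller red) a
              (JacobiLSeries.monicImage α r) =
          ∑ i : {k : Fin d // r < k} → Fin r → Fin (Nat.card F - 1),
            JacobiLSeries.jacobiSumForm (JacobiLSeries.teichmuller red)
                (Fin.snoc (fun s => -β ⟨r, hr⟩ s) 1 : Fin (r + 1) → F) (-β₀ ⟨r, hr⟩)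
                (Fin.snoc (fun s => (∑ k, ((i k s : ℕ) : ℤ)) + a (s.castLE hr.le)) (a ⟨r, hr⟩) :
                  Fin (r + 1) → ℤ) *
              ∏ k : {k : Fin d // r < k},
                JacobiLSeries.jacobiSumForm (JacobiLSeries.teichmuller red)
                  (Fin.snoc (fun s => -β k s) 1 : Fin (r + 1) → F) (-β₀ k)
                  (Fin.snoc (fun s => -((i k s : ℕ) : ℤ)) (a k) : Fin (r + 1) → ℤ) := by
  have hq : 0 < Nat.card F - 1 := by have := Finite.one_lt_card (α := F); omega
  -- For `d = 0` the exponent sum would be `0`, which `n` divides.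
  have hd : 0 < d := by
    rcases Nat.eq_zero_or_pos d with rfl | hd
    · simp at h_infty
    · exact hd
  have hn0 : 0 < n := (hm ⟨0, hd⟩).1.trans (hm ⟨0, hd⟩).2
  have he : 0 < (Nat.card F - 1) / n := Nat.div_pos (Nat.le_of_dvd hq hn) hn0
  have ha' (i : Fin d) : a i = ((m i * ((Nat.card F - 1) / n) : ℕ) : ℤ) := by
    rw [ha, Nat.cast_mul]
  obtain rfl : a = fun i => ((m i * ((Nat.card F - 1) / n) : ℕ) : ℤ) := funext ha'
  refine ⟨?_, fun r hr => ?_⟩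
  · rw [← JacobiLSeries.monicSeries_evalChar _ _ _ hα (fun i =>
      JacobiLSeries.teichmuller_zpow_ne_one red (Nat.mul_pos (hm i).1 he) ?_) hd]
    · exact JacobiLSeries.hasProd_monicSeries (JacobiLSeries.evalChar_one _ _ _)
        (JacobiLSeries.evalChar_mul _ _ _) rfl fun P hP hPi =>
          JacobiLSeries.charAt_finite red hn α (fun i => (hm i).1) hc hg hy hY hP hPi
    · calc m i * ((Nat.card F - 1) / n) < n * ((Nat.card F - 1) / n) :=
          Nat.mul_lt_mul_of_pos_right (hm i).2 he
        _ = Nat.card F - 1 := Nat.mul_div_cancel' hn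
  · refine ⟨_, _, JacobiLSeries.monicImage_eq_setOf_affine hα hr, ?_⟩
    rw [JacobiLSeries.monicImage_eq_setOf_affine hα hr]
    exact JacobiLSeries.card_sub_one_pow_mul_jacobiSumOn hr red _ _ _
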